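/- Let $n\ge 2$ and $k\ge 0$ be integers. Write points of $\mathbb C^{2n}\cong\mathbb R^{4n}$ as pairs $(z,w)\in\mathbb C^n\times\mathbb C^n$ and let $\mathcal H^k$ be the complex vector space of complex-valued harmonic polynomial functions on $\mathbb R^{4n}$ that are homogeneous of degree $k$. The group $Sp(n)=U(2n)\cap Sp(n,\mathbb C)$ acts on functions on the left by $L(u)f(x)=f(u^{-1}x)$. The group $Sp(1)$ of unit quaternions $q=a+jb$ ($a,b\in\mathbb C$, $|a|^2+|b|^2=1$) acts by the right action $$R(q)f(z,w)=f(az-b\overline w,\;aw+b\overline z),$$ which comes from right multiplication of $z+jw\in\mathbb H^n$ by $q$. For integers $\alpha,\beta\ge 0$ with $\alpha+\beta=k$ and $0\le\gamma\le\min(\alpha,\beta)$, let $V_\gamma^{\alpha,\beta}\subset\mathcal H^k$ be the irreducible component for the left action of $Sp(n)$ generated by the highest weight vector $$P_\gamma^{\alpha,\beta}(z,w)=w_1^{\alpha-\gamma}\,\overline{z_1}^{\,\beta-\gamma}\,(w_2\overline{z_1}-w_1\overline{z_2})^\gamma ,$$ that is, the linear span of all $L(u)P_\gamma^{\alpha,\beta}$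 with $u\in Sp(n)$. If $\mathcal H^k$ contains a one-dimensional complex subspace that is stable under the right action of $Sp(1)$, then $k$ is even. If $k$ is even and $m=k/2$, then $V_m^{m,m}$ contains such a subspace and is the only one of the components $V_\gamma^{\alpha,\beta}$ ($\alpha+\beta=k$, $0\le\gamma\le\min(\alpha,\beta)$) that does; moreover, every element of $V_m^{m,m}$ is invariant under the right action of $Sp(1)$. -/

import Mathlib

noncomputable section

namespace QuaternionicHarmonics

open Matrix ComplexConjugate

/-- The space `ℂ²ⁿ ≅ ℝ⁴ⁿ ≅ ℍⁿ`. Its points are written `(z, w)` with `z, w ∈ ℂⁿ`: the coordinate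
`zᵢ` has index `Sum.inl i` and the coordinate `wᵢ` has index `Sum.inr i`; the corresponding
quaternionic vector is `z + j w`. -/
abbrev Space (n : ℕ) : Type := EuclideanSpace ℂ (Fin n ⊕ Fin n)

/-- The `4n` real coordinates (real and imaginary parts) of a point, seen as complex numbers. -/
def realCoords {n : ℕ} (x : Space n) : (Fin n ⊕ Fin n) ⊕ (Fin n ⊕ Fin n) → ℂ :=
  Sum.elim (fun i => ((x i).re : ℂ)) (fun i => ((x i).im : ℂ))

/-- Complex-valued functions on `ℝ⁴ⁿ` that are homogeneous polynomials of degree `k` in the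
`4n` real coordinates. -/
def IsHomPoly {n : ℕ} (k : ℕ) (f : Space n → ℂ) : Prop :=
  ∃ p : MvPolynomial ((Fin n ⊕ Fin n) ⊕ (Fin n ⊕ Fin n)) ℂ,
    p.IsHomogeneous k ∧ ∀ x, f x = MvPolynomial.eval (realCoords x) p

/-- `ℋᵏ`: the complex vector space of harmonic polynomial functions on `ℝ⁴ⁿ`, homogeneous of
degree `k`. -/
def harm (n k : ℕ) : Submodule ℂ (Space n → ℂ) where
  carrier := {f | IsHomPoly k f ∧ InnerProductSpace.HarmonicOnNhd f Set.univ}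
  zero_mem' := by
    refine ⟨⟨0, MvPolynomial.isHomogeneous_zero _ _ _, fun x => by simp⟩, ?_⟩
    exact InnerProductSpace.harmonicOnNhd_const (0 : ℂ)
  add_mem' := by
    rintro f g ⟨⟨p, hp, hpf⟩, hf⟩ ⟨⟨q, hq, hqg⟩, hg⟩
    exact ⟨⟨p + q, hp.add hq, fun x => by simp [hpf, hqg]⟩, hf.add hg⟩
  smul_mem' := by
    rintro c f ⟨⟨p, hp, hpf⟩, hf⟩
    refine ⟨⟨MvPolynomial.C c * p, hp.C_mul c, fun x => by simp [hpf]⟩, ?_⟩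
    exact hf.comp_CLM ((c • ContinuousLinearMap.id ℂ ℂ).restrictScalars ℝ)

/-- The compact symplectic group `Sp(n) = U(2n) ∩ Sp(n, ℂ)`, i.e. the unitary matrices of the
block form `(A, -B̄; B, Ā)`. -/
def Sp (n : ℕ) : Submonoid (Matrix (Fin n ⊕ Fin n) (Fin n ⊕ Fin n) ℂ) :=
  Matrix.unitaryGroup (Fin n ⊕ Fin n) ℂ ⊓ Matrix.symplecticGroup (Fin n) ℂ

/-- The left action of matrices on functions: `(L(u) f)(x) = f(u⁻¹ x)`. -/
def leftAct {n : ℕ} (u : Matrix (Fin n ⊕ Fin n) (Fin n ⊕ Fin n) ℂ) (f : Space n → ℂ) :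
    Space n → ℂ :=
  fun x => f (WithLp.toLp 2 (u⁻¹ *ᵥ x.ofLp))

/-- `Sp(1)`, as the unit quaternions `q = a + j b`, written as pairs `(a, b)`. -/
def UnitQuaternion : Type := {q : ℂ × ℂ // ‖q.1‖ ^ 2 + ‖q.2‖ ^ 2 = 1}

/-- Right multiplication of `z + j w` by the quaternion `a + j b`:
`(z, w) ↦ (a z - b w̄, a w + b z̄)`. -/
def mulRight {n : ℕ} (a b : ℂ) (x : Space n) : Space n :=
  WithLp.toLp 2 (Sum.elim
    (fun i => a * x (Sum.inl i) - b * conj (x (Sum.inr i)))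
    (fun i => a * x (Sum.inr i) + b * conj (x (Sum.inl i))))

/-- The right action of `Sp(1)` on functions: `(R(q) f)(h) = f(h q)`. -/
def rightAct {n : ℕ} (q : UnitQuaternion) (f : Space n → ℂ) : Space n → ℂ :=
  fun x => f (mulRight q.1.1 q.1.2 x)

/-- A subspace of functions is stable under the right action of `Sp(1)`. -/
def IsRightStable {n : ℕ} (S : Submodule ℂ (Space n → ℂ)) : Prop :=
  ∀ q : UnitQuaternion, ∀ f ∈ S, rightAct q f ∈ S

/-- The highest weight vector
`P_γ^{α,β}(z, w, z̄, w̄) = w₁^{α-γ} z̄₁^{β-γ} (w₂ z̄₁ - w₁ z̄₂)^γ`, for `γ ≤ min(α, β)`. -/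
def highestWeightVector {n : ℕ} (hn : 2 ≤ n) (α β γ : ℕ) : Space n → ℂ := fun x =>
  let i₁ : Fin n := ⟨0, by omega⟩
  let i₂ : Fin n := ⟨1, by omega⟩
  x (Sum.inr i₁) ^ (α - γ) * conj (x (Sum.inl i₁)) ^ (β - γ) *
    (x (Sum.inr i₂) * conj (x (Sum.inl i₁)) - x (Sum.inr i₁) * conj (x (Sum.inl i₂))) ^ γ

/-- The component `V_γ^{α,β}`: the irreducible subspace for the left action of `Sp(n)` that is
generated by the highest weight vector `P_γ^{α,β}`, i.e. the span of the `Sp(n)`-translates of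
that vector. -/
def component {n : ℕ} (hn : 2 ≤ n) (α β γ : ℕ) : Submodule ℂ (Space n → ℂ) :=
  Submodule.span ℂ {f | ∃ u ∈ Sp n, f = leftAct u (highestWeightVector hn α β γ)}

end QuaternionicHarmonics

end

open QuaternionicHarmonics

/-!
The left action of `Sp n` commutes with right multiplication by quaternions, so whatever the right
action does to a highest weight vector it does to the whole component. For `α = β = γ = m` the
highest weight vector is a power of `w₂ z̄₁ - w₁ z̄₂`, which is right invariant; hence all of
`V_m^{m,m}` is.

A stable line is spanned by an `f` with `R(q) f = χ(q) f` for scalars `χ(q)`. If `q = a + j b`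
with `a` real, then `q i = i q⁻¹`, so `q²` is a commutator and `f` is fixed by `R(q²)`
(`apply_mulRight_sq_of_eigen`). For `q = j` this says `f (-x) = f x`, which is incompatible with
odd degree. Every unit quaternion `a + j b` with `a` real and positive is such a square, so `f` is
fixed by all of these (`apply_mulRight_of_eigen`).

It remains to see that only `γ = m` is possible. Put `p = α - γ`, `q = β - γ`, `p + q = 2d`. Along
the two curves of unit quaternions proportional to `1 + j t` and to `1 + j i t` (`t` real), the
function `(1 + t²)ᵈ R(·) f (x)` is a polynomial in `t`, for every `f` in the component. Adding the
coefficients of `t²` for the two curves gives `-2 p q f(x)` (`exists_polynomial_of_mem_component`):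
this can be read off the highest weight vector, where all other terms cancel. This is a second-order
substitute for the Casimir operator of the right action. For an invariant `f` the same sum is
`2 d f(x)`. So `(d + p q) f = 0`, which forces `d = 0` as soon as `f ≠ 0`.
-/

open QuaternionicHarmonics

namespace QuaternionicHarmonics

open Matrix ComplexConjugate Polynomial

variable {n : ℕ}

/-! ### Right multiplication by quaternions and the left action -/

lemma mulRight_mulRight (a b c d : ℂ) (x : Space n) :
    mulRight c d (mulRight a b x) = mulRight (a * c - conj b * d) (b * c + conj a * d) x := by
  ext i
  rcases i with i | i <;> simp [mulRight] <;> ring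

lemma mulRight_one_zero (x : Space n) : mulRight 1 0 x = x := by
  ext i
  rcases i with i | i <;> simp [mulRight]

lemma mulRight_neg_one_zero (x : Space n) : mulRight (-1) 0 x = -x := by
  ext i
  rcases i with i | i <;> simp [mulRight]

lemma mulRight_eq_add (a b : ℂ) (x : Space n) :
    (mulRight a b x).ofLp = a • x.ofLp + b • (J (Fin n) ℂ *ᵥ star x.ofLp) := by
  ext i
  rcases i with i | i <;>
    simp [mulRight, J, Matrix.fromBlocks_mulVec, Matrix.neg_mulVec, sub_eq_add_neg]

lemma inv_eq_star_of_mem_Sp {u : Matrix (Fin n ⊕ Fin n) (Fin n ⊕ Fin n) ℂ} (hu : u ∈ Sp n) :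
    u⁻¹ = star u :=
  Matrix.inv_eq_left_inv (Matrix.mem_unitaryGroup_iff'.1 hu.1)

/-- The antilinear map `x ↦ J x̄`, right multiplication by `j`, commutes with `Sp(n)`. -/
lemma inv_mul_J {u : Matrix (Fin n ⊕ Fin n) (Fin n ⊕ Fin n) ℂ} (hu : u ∈ Sp n) :
    u⁻¹ * J (Fin n) ℂ = J (Fin n) ℂ * uᵀ := by
  have h1 : star u * u = 1 := Matrix.mem_unitaryGroup_iff'.1 hu.1
  have h2 : u * J (Fin n) ℂ * uᵀ = J (Fin n) ℂ := SymplecticGroup.mem_iff.1 hu.2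
  rw [inv_eq_star_of_mem_Sp hu]
  nth_rewrite 1 [← h2]
  simp only [← Matrix.mul_assoc]
  rw [h1, Matrix.one_mul]

lemma inv_mulVec_mulRight {u : Matrix (Fin n ⊕ Fin n) (Fin n ⊕ Fin n) ℂ} (hu : u ∈ Sp n)
    (a b : ℂ) (x : Space n) :
    WithLp.toLp 2 (u⁻¹ *ᵥ (mulRight a b x).ofLp) =
      mulRight a b (WithLp.toLp 2 (u⁻¹ *ᵥ x.ofLp)) := by
  refine WithLp.ofLp_injective 2 ?_
  have h : star (u⁻¹ *ᵥ x.ofLp) = uᵀ *ᵥ star x.ofLp := by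
    rw [Matrix.star_mulVec, inv_eq_star_of_mem_Sp hu, Matrix.star_eq_conjTranspose,
      Matrix.conjTranspose_conjTranspose, Matrix.mulVec_transpose]
  simp only [mulRight_eq_add, h, Matrix.mulVec_add, Matrix.mulVec_smul, Matrix.mulVec_mulVec,
    inv_mul_J hu]

lemma leftAct_mulRight {u : Matrix (Fin n ⊕ Fin n) (Fin n ⊕ Fin n) ℂ} (hu : u ∈ Sp n)
    (f : Space n → ℂ) (a b : ℂ) (x : Space n) :
    leftAct u f (mulRight a b x) = f (mulRight a b (WithLp.toLp 2 (u⁻¹ *ᵥ x.ofLp))) := by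
  rw [leftAct, inv_mulVec_mulRight hu]

/-! ### Eigenvectors of the right action -/

lemma exists_eigen_of_isRightStable {S : Submodule ℂ (Space n → ℂ)}
    (h1 : Module.finrank ℂ S = 1) (hS : IsRightStable S) :
    ∃ f ∈ S, f ≠ 0 ∧ ∀ q : UnitQuaternion, ∃ c : ℂ, rightAct q f = c • f := by
  obtain ⟨⟨f, hf⟩, hf0, h⟩ := finrank_eq_one_iff'.1 h1
  refine ⟨f, hf, fun h0 => hf0 (Subtype.ext h0), fun q => ?_⟩
  obtain ⟨c, hc⟩ := h ⟨_, hS q f hf⟩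
  exact ⟨c, (congrArg Subtype.val hc).symm⟩

/-- For unit `q = a + j b` with `a` real, `q i = i q⁻¹`, so `q²` is a commutator and acts trivially
on a common eigenvector of the right action. -/
lemma apply_mulRight_sq_of_eigen {f : Space n → ℂ}
    (hf : ∀ q : UnitQuaternion, ∃ c : ℂ, rightAct q f = c • f) {a : ℝ} {b : ℂ}
    (hab : ‖(a : ℂ)‖ ^ 2 + ‖b‖ ^ 2 = 1) (x : Space n) :
    f (mulRight (a * a - conj b * b) (2 * a * b) x) = f x := by
  have hb : (a : ℂ) * a + conj b * b = 1 := by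
    rw [Complex.conj_mul']
    rw [Complex.norm_real, Real.norm_eq_abs, sq_abs] at hab
    rw [← sq]
    exact_mod_cast hab
  have key : ∀ (a b : ℂ), ‖a‖ ^ 2 + ‖b‖ ^ 2 = 1 → ∃ c : ℂ, ∀ x, f (mulRight a b x) = c * f x :=
    fun a b h => (hf ⟨(a, b), h⟩).imp fun c hc x => congrFun hc x
  obtain ⟨l, hl⟩ := key a b hab
  obtain ⟨l', hl'⟩ := key a (-b) (by rw [norm_neg]; exact hab)
  obtain ⟨μ, hμ⟩ := key Complex.I 0 (by simp)
  obtain ⟨ν, hν⟩ := key (-Complex.I) 0 (by simp)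
  have hll (y : Space n) : l' * (l * f y) = f y := by
    rw [← hl, ← hl', mulRight_mulRight]
    convert congrArg f (mulRight_one_zero y) using 3
    · linear_combination hb
    · rw [Complex.conj_ofReal]; ring
  have hmn (y : Space n) : ν * (μ * f y) = f y := by
    rw [← hμ, ← hν, mulRight_mulRight]
    convert congrArg f (mulRight_one_zero y) using 3 <;> simp
  -- `q² i = q i q⁻¹`
  have h : mulRight Complex.I 0 (mulRight (a * a - conj b * b) (2 * a * b) x) =
      mulRight a (-b) (mulRight Complex.I 0 (mulRight a b x)) := by
    simp only [mulRight_mulRight]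
    congr 1 <;> simp <;> ring
  have h2 := congrArg f h
  rw [hμ, hl', hμ, hl] at h2
  calc _ = ν * (μ * f (mulRight (a * a - conj b * b) (2 * a * b) x)) := (hmn _).symm
    _ = ν * (μ * (l' * (l * f x))) := by rw [h2]; ring
    _ = f x := by rw [hll, hmn]

lemma apply_neg_of_eigen {f : Space n → ℂ}
    (hf : ∀ q : UnitQuaternion, ∃ c : ℂ, rightAct q f = c • f) (x : Space n) :
    f (-x) = f x := by
  have h := apply_mulRight_sq_of_eigen hf (a := 0) (b := 1) (by simp) x
  simpa [mulRight_neg_one_zero] using h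

lemma apply_mulRight_of_eigen {f : Space n → ℂ}
    (hf : ∀ q : UnitQuaternion, ∃ c : ℂ, rightAct q f = c • f) {a : ℝ} (ha : 0 < a) {b : ℂ}
    (hab : a ^ 2 + ‖b‖ ^ 2 = 1) (x : Space n) :
    f (mulRight a b x) = f x := by
  -- the square root of `q = a + j b` is `(1 + q) / s`, where `s² = |1 + q|² = 2 (1 + a)`
  obtain ⟨s, hs0, hs⟩ : ∃ s : ℝ, s ≠ 0 ∧ s ^ 2 = 2 * (1 + a) :=
    ⟨√(2 * (1 + a)), by positivity, Real.sq_sqrt (by positivity)⟩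
  have hsC : (s : ℂ) ≠ 0 := by exact_mod_cast hs0
  have hsC2 : (s : ℂ) ^ 2 = 2 * (1 + a) := by exact_mod_cast hs
  have hb : conj b * b = 1 - (a : ℂ) ^ 2 := by
    rw [Complex.conj_mul']
    exact_mod_cast eq_sub_of_add_eq' hab
  have h := apply_mulRight_sq_of_eigen hf (a := (1 + a) / s) (b := b / s) (by
    rw [Complex.norm_real, norm_div, norm_div, Complex.norm_real, div_pow, div_pow,
      Real.norm_eq_abs, Real.norm_eq_abs, sq_abs, sq_abs, ← add_div, hs, div_eq_one_iff_eq]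
    · linear_combination hab
    · positivity) x
  convert h using 3
  · simp only [map_div₀, Complex.conj_ofReal, Complex.ofReal_div, Complex.ofReal_add,
      Complex.ofReal_one]
    field_simp
    linear_combination hb + (a : ℂ) * hsC2
  · simp only [Complex.ofReal_div, Complex.ofReal_add, Complex.ofReal_one]
    field_simp
    linear_combination b * hsC2

lemma IsHomPoly.apply_neg {k : ℕ} {f : Space n → ℂ} (hf : IsHomPoly k f) (x : Space n) :
    f (-x) = (-1) ^ k * f x := by
  obtain ⟨p, hp, h⟩ := hf
  have hx : realCoords (-x) = -realCoords x := by
    ext i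
    rcases i with i | i <;> simp [realCoords]
  rw [h, h, hx, MvPolynomial.eval_eq, MvPolynomial.eval_eq, Finset.mul_sum]
  refine Finset.sum_congr rfl fun d hd => ?_
  have hdk : ∑ i ∈ d.support, d i = k := by
    have := hp (MvPolynomial.mem_support_iff.1 hd)
    simpa [Finsupp.weight_apply, Finsupp.sum] using this
  simp only [Pi.neg_apply, neg_pow (realCoords x _)]
  rw [Finset.prod_mul_distrib, Finset.prod_pow_eq_pow_sum, hdk]
  ring

/-! ### The highest weight vectors under right multiplication -/

lemma highestWeightVector_mulRight (hn : 2 ≤ n) (α β γ : ℕ) (a b : ℂ)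
    (hab : a * conj a + b * conj b = 1) (x : Space n) :
    highestWeightVector hn α β γ (mulRight a b x) =
      (a * x (Sum.inr ⟨0, by omega⟩) + b * conj (x (Sum.inl ⟨0, by omega⟩))) ^ (α - γ) *
      (conj a * conj (x (Sum.inl ⟨0, by omega⟩)) - conj b * x (Sum.inr ⟨0, by omega⟩)) ^ (β - γ) *
      (x (Sum.inr ⟨1, by omega⟩) * conj (x (Sum.inl ⟨0, by omega⟩)) -
        x (Sum.inr ⟨0, by omega⟩) * conj (x (Sum.inl ⟨1, by omega⟩))) ^ γ := by
  simp only [highestWeightVector, mulRight, Sum.elim_inl, Sum.elim_inr, map_sub, map_mul,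
    Complex.conj_conj]
  congr 2
  linear_combination (x (Sum.inr ⟨1, by omega⟩) * conj (x (Sum.inl ⟨0, by omega⟩)) -
    x (Sum.inr ⟨0, by omega⟩) * conj (x (Sum.inl ⟨1, by omega⟩))) * hab

lemma highestWeightVector_self_ne_zero (hn : 2 ≤ n) (m : ℕ) :
    highestWeightVector hn m m m ≠ 0 := by
  intro h
  -- the point with `z₁ = w₂ = 1` and all other coordinates zero
  have := congrFun h (WithLp.toLp 2 (Sum.elim
    (fun i => if i = ⟨0, by omega⟩ then 1 else 0) (fun i => if i = ⟨1, by omega⟩ then 1 else 0)))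
  simp [highestWeightVector] at this

lemma highestWeightVector_mem_component (hn : 2 ≤ n) (α β γ : ℕ) :
    highestWeightVector hn α β γ ∈ component hn α β γ :=
  Submodule.subset_span ⟨1, one_mem _, by ext x; simp [leftAct]⟩

theorem rightAct_eq_self_of_mem_component (hn : 2 ≤ n) (m : ℕ) {f : Space n → ℂ}
    (hf : f ∈ component hn m m m) (q : UnitQuaternion) : rightAct q f = f := by
  obtain ⟨⟨a, b⟩, hq⟩ := q
  have hab : a * conj a + b * conj b = 1 := by
    rw [Complex.mul_conj', Complex.mul_conj']
    exact_mod_cast hq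
  induction hf using Submodule.span_induction with
  | mem f h =>
    obtain ⟨u, hu, rfl⟩ := h
    ext x
    simp only [rightAct]
    rw [leftAct_mulRight hu, highestWeightVector_mulRight hn _ _ _ a b hab, leftAct]
    simp [highestWeightVector]
  | zero => rfl
  | add f g _ _ hf hg => exact congrArg₂ (· + ·) hf hg
  | smul c f _ hf => exact congrArg (c • ·) hf

/-! ### The second-order identity -/

lemma coeff_C_add_C_mul_X_pow {R : Type*} [CommRing R] (a b : R) (n k : ℕ) :
    ((C a + C b * X) ^ n).coeff k = a ^ (n - k) * n.choose k * b ^ k := by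
  have h : (C a + C b * X) ^ n = ((X + C a) ^ n).comp (C b * X) := by
    simp [add_comm]
  rw [h, comp_C_mul_X_coeff, coeff_X_add_C_pow]

/-- The coefficients of `t²` on the curves `1 + j t` and `1 + j i t`: the contributions of the
second order in a single factor cancel between the two curves. -/
lemma coeff_two_add_coeff_two (v u : ℂ) (p q : ℕ) :
    ((C v + C u * X) ^ p * (C u + C (-v) * X) ^ q).coeff 2 +
      ((C v + C (Complex.I * u) * X) ^ p * (C u + C (Complex.I * v) * X) ^ q).coeff 2 =
      -2 * p * q * (v ^ p * u ^ q) := by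
  have hp : (p : ℂ) * (v ^ (p - 1) * v) = p * v ^ p := by
    rcases p with _ | p <;> simp [pow_succ]
  have hq : (q : ℂ) * (u ^ (q - 1) * u) = q * u ^ q := by
    rcases q with _ | q <;> simp [pow_succ]
  have hI : Complex.I ^ 2 = -1 := Complex.I_sq
  have h2 : Finset.HasAntidiagonal.antidiagonal (2 : ℕ) = {(0, 2), (1, 1), (2, 0)} := rfl
  simp only [coeff_mul, h2, coeff_C_add_C_mul_X_pow]
  simp only [Finset.mem_insert, Prod.mk.injEq, Finset.mem_singleton, zero_ne_one, one_ne_zero,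
    OfNat.ofNat_ne_zero, OfNat.zero_ne_ofNat, false_and, and_false, or_self, not_false_eq_true,
    Finset.sum_insert, Finset.sum_singleton, Nat.choose_zero_right, Nat.choose_one_right,
    Nat.cast_one, pow_zero, pow_one, mul_one, OfNat.one_ne_ofNat, Nat.sub_zero, mul_pow, hI]
  linear_combination (-2 * q * (u ^ (q - 1) * u)) * hp - 2 * p * v ^ p * hq +
    p * q * (v ^ (p - 1) * v) * (u ^ (q - 1) * u) * hI

/-- The complex part of the unit quaternions proportional to `1 + j t` and to `1 + j i t`. -/
noncomputable def cosOfTan (t : ℝ) : ℝ := (√(1 + t ^ 2))⁻¹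

lemma cosOfTan_pos (t : ℝ) : 0 < cosOfTan t := by
  unfold cosOfTan; positivity

lemma cosOfTan_sq_mul (t : ℝ) : cosOfTan t ^ 2 * (1 + t ^ 2) = 1 := by
  rw [cosOfTan, inv_pow, Real.sq_sqrt (by positivity), inv_mul_cancel₀ (by positivity)]

lemma norm_cosOfTan_mul_sq (t : ℝ) {e : ℂ} (he : ‖e‖ = 1) :
    cosOfTan t ^ 2 + ‖(cosOfTan t * (t * e) : ℂ)‖ ^ 2 = 1 := by
  rw [norm_mul, norm_mul, he, Complex.norm_real, Complex.norm_real, mul_pow, mul_one,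
    Real.norm_eq_abs, Real.norm_eq_abs, sq_abs, sq_abs]
  linear_combination cosOfTan_sq_mul t

/-- The polynomial in `t` that describes the action of the unit quaternion proportional to
`1 + j e t` on the highest weight vector at the point `x`, up to the power of `1 + t²` in the
denominator. -/
noncomputable def curvePolynomial (hn : 2 ≤ n) (α β γ : ℕ) (e : ℂ) (x : Space n) : ℂ[X] :=
  (C (x (Sum.inr ⟨0, by omega⟩)) + C (e * conj (x (Sum.inl ⟨0, by omega⟩))) * X) ^ (α - γ) *
    (C (conj (x (Sum.inl ⟨0, by omega⟩))) +
      C (-conj e * x (Sum.inr ⟨0, by omega⟩)) * X) ^ (β - γ) *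
    C ((x (Sum.inr ⟨1, by omega⟩) * conj (x (Sum.inl ⟨0, by omega⟩)) -
      x (Sum.inr ⟨0, by omega⟩) * conj (x (Sum.inl ⟨1, by omega⟩))) ^ γ)

lemma highestWeightVector_mulRight_cosOfTan (hn : 2 ≤ n) {α β γ d : ℕ}
    (hd : (α - γ) + (β - γ) = 2 * d) {e : ℂ} (he : ‖e‖ = 1) (t : ℝ) (x : Space n) :
    (1 + (t : ℂ) ^ 2) ^ d *
        highestWeightVector hn α β γ (mulRight (cosOfTan t) (cosOfTan t * (t * e)) x) =
      (curvePolynomial hn α β γ e x).eval (t : ℂ) := by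
  have hab : (cosOfTan t : ℂ) * conj (cosOfTan t : ℂ) +
      (cosOfTan t * (t * e)) * conj (cosOfTan t * (t * e) : ℂ) = 1 := by
    rw [Complex.mul_conj', Complex.mul_conj', Complex.norm_real, Real.norm_eq_abs,
      ← Complex.ofReal_pow, sq_abs]
    exact_mod_cast norm_cosOfTan_mul_sq t he
  have hc : (cosOfTan t : ℂ) ^ 2 * (1 + (t : ℂ) ^ 2) = 1 := by
    exact_mod_cast cosOfTan_sq_mul t
  have hcd : (1 + (t : ℂ) ^ 2) ^ d * ((cosOfTan t : ℂ) ^ (α - γ) * (cosOfTan t : ℂ) ^ (β - γ)) =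
      1 := by
    rw [← pow_add, hd, pow_mul, ← mul_pow, mul_comm, hc, one_pow]
  rw [highestWeightVector_mulRight hn _ _ _ _ _ hab]
  simp only [curvePolynomial, eval_mul, eval_pow, eval_add, eval_C, eval_X, map_mul,
    Complex.conj_ofReal]
  generalize (_ - _ : ℂ) ^ γ = D
  generalize x (Sum.inr _) = v
  generalize conj (x (Sum.inl ⟨0, _⟩)) = u
  have h1 : (cosOfTan t : ℂ) * v + cosOfTan t * (t * e) * u =
      cosOfTan t * (v + e * u * t) := by ring
  have h2 : (cosOfTan t : ℂ) * u - cosOfTan t * (t * conj e) * v =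
      cosOfTan t * (u + -conj e * v * t) := by ring
  rw [h1, h2, mul_pow, mul_pow]
  generalize (v + e * u * t) ^ (α - γ) = A
  generalize (u + -conj e * v * t) ^ (β - γ) = B
  linear_combination A * B * D * hcd

/-- On a component, the right action along the curves `1 + j t` and `1 + j i t` is polynomial in
`t` after clearing denominators, and the two coefficients of `t²` add up to a fixed multiple of the
function. -/
lemma exists_polynomial_of_mem_component (hn : 2 ≤ n) {α β γ d : ℕ}
    (hd : (α - γ) + (β - γ) = 2 * d) {f : Space n → ℂ} (hf : f ∈ component hn α β γ)
    (x : Space n) :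
    ∃ A B : ℂ[X],
      (∀ t : ℝ, (1 + (t : ℂ) ^ 2) ^ d * f (mulRight (cosOfTan t) (cosOfTan t * (t * 1)) x) =
        A.eval (t : ℂ)) ∧
      (∀ t : ℝ, (1 + (t : ℂ) ^ 2) ^ d *
        f (mulRight (cosOfTan t) (cosOfTan t * (t * Complex.I)) x) = B.eval (t : ℂ)) ∧
      A.coeff 2 + B.coeff 2 = -2 * (α - γ : ℕ) * (β - γ : ℕ) * f x := by
  induction hf using Submodule.span_induction with
  | mem f h =>
    obtain ⟨u, hu, rfl⟩ := h
    simp only [leftAct_mulRight hu]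
    rw [leftAct]
    generalize (WithLp.toLp 2 (u⁻¹ *ᵥ x.ofLp) : Space n) = y
    refine ⟨curvePolynomial hn α β γ 1 y, curvePolynomial hn α β γ Complex.I y,
      fun t => highestWeightVector_mulRight_cosOfTan hn hd (by simp) t y,
      fun t => highestWeightVector_mulRight_cosOfTan hn hd (by simp) t y, ?_⟩
    have h := coeff_two_add_coeff_two (y (Sum.inr ⟨0, by omega⟩))
      (conj (y (Sum.inl ⟨0, by omega⟩))) (α - γ) (β - γ)
    simp only [curvePolynomial, coeff_mul_C, ← add_mul, map_one, one_mul, Complex.conj_I, neg_neg,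
      neg_mul] at h ⊢
    rw [h]
    simp only [highestWeightVector]
    ring
  | zero => exact ⟨0, 0, by simp, by simp, by simp⟩
  | add f g _ _ hf hg =>
    obtain ⟨A, B, hA, hB, h⟩ := hf
    obtain ⟨A', B', hA', hB', h'⟩ := hg
    refine ⟨A + A', B + B', fun t => ?_, fun t => ?_, ?_⟩
    · rw [Pi.add_apply, mul_add, hA, hA', eval_add]
    · rw [Pi.add_apply, mul_add, hB, hB', eval_add]
    · rw [coeff_add, coeff_add, Pi.add_apply]
      linear_combination h + h'
  | smul c f _ hf =>
    obtain ⟨A, B, hA, hB, h⟩ := hf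
    refine ⟨c • A, c • B, fun t => ?_, fun t => ?_, ?_⟩
    · rw [Pi.smul_apply, eval_smul, ← hA, smul_eq_mul, smul_eq_mul]; ring
    · rw [Pi.smul_apply, eval_smul, ← hB, smul_eq_mul, smul_eq_mul]; ring
    · rw [coeff_smul, coeff_smul, Pi.smul_apply, smul_eq_mul, smul_eq_mul, smul_eq_mul]
      linear_combination c * h

lemma coeff_two_of_eval_ofReal_eq {A : ℂ[X]} {d : ℕ} {c : ℂ}
    (h : ∀ t : ℝ, (1 + (t : ℂ) ^ 2) ^ d * c = A.eval (t : ℂ)) : A.coeff 2 = d * c := by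
  have hA : A = (1 + X ^ 2) ^ d * C c := by
    refine Polynomial.eq_of_infinite_eval_eq _ _
      ((Set.infinite_range_of_injective Complex.ofReal_injective).mono ?_)
    rintro _ ⟨t, rfl⟩
    simp [← h t]
  have hX : ((1 + X ^ 2 : ℂ[X]) ^ d) = expand ℂ 2 ((1 + X) ^ d) := by simp
  rw [hA, coeff_mul_C, hX, show (2 : ℕ) = 1 * 2 from rfl, coeff_expand_mul (by norm_num),
    coeff_one_add_X_pow, Nat.choose_one_right]

theorem eq_zero_of_mem_component_of_eigen (hn : 2 ≤ n) {α β γ d : ℕ}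
    (hd : (α - γ) + (β - γ) = 2 * d) {f : Space n → ℂ} (hf : f ∈ component hn α β γ) (hf0 : f ≠ 0)
    (h : ∀ q : UnitQuaternion, ∃ c : ℂ, rightAct q f = c • f) : d = 0 := by
  obtain ⟨x, hx⟩ := Function.ne_iff.1 hf0
  obtain ⟨A, B, hA, hB, hAB⟩ := exists_polynomial_of_mem_component hn hd hf x
  have inv (t : ℝ) (e : ℂ) (he : ‖e‖ = 1) :
      f (mulRight (cosOfTan t) (cosOfTan t * (t * e)) x) = f x :=
    apply_mulRight_of_eigen h (cosOfTan_pos t) (norm_cosOfTan_mul_sq t he) x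
  rw [coeff_two_of_eval_ofReal_eq (c := f x) fun t => by rw [← hA, inv t 1 (by simp)],
    coeff_two_of_eval_ofReal_eq (c := f x) fun t => by rw [← hB, inv t Complex.I (by simp)]] at hAB
  have h0 : ((d + (α - γ) * (β - γ) : ℕ) : ℂ) * f x = 0 := by
    push_cast only [Nat.cast_add, Nat.cast_mul]
    linear_combination hAB / 2
  rcases mul_eq_zero.1 h0 with h0 | h0
  · exact (Nat.add_eq_zero_iff.1 (Nat.cast_eq_zero.1 h0)).1
  · exact absurd h0 hx

end QuaternionicHarmonics

theorem corollary3 (n : ℕ) (hn : 2 ≤ n) (k : ℕ) :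
    ((∃ S : Submodule ℂ (Space n → ℂ),
        S ≤ harm n k ∧ Module.finrank ℂ S = 1 ∧ IsRightStable S) → Even k) ∧
    ∀ m : ℕ, k = 2 * m →
      (∀ α β γ : ℕ, α + β = k → γ ≤ min α β →
        ((∃ S : Submodule ℂ (Space n → ℂ),
            S ≤ component hn α β γ ∧ Module.finrank ℂ S = 1 ∧ IsRightStable S) ↔
          (α = m ∧ β = m ∧ γ = m))) ∧
      ∀ f ∈ component hn m m m, ∀ q : UnitQuaternion, rightAct q f = f := by
  refine ⟨?_, fun m hk => ⟨fun α β γ hαβ hγ => ⟨?_, ?_⟩,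
    fun f hf q => rightAct_eq_self_of_mem_component hn m hf q⟩⟩
  · rintro ⟨S, hSk, hS1, hS⟩
    obtain ⟨f, hfS, hf0, hf⟩ := exists_eigen_of_isRightStable hS1 hS
    by_contra hk
    obtain ⟨x, hx⟩ := Function.ne_iff.1 hf0
    have h := (hSk hfS).1.apply_neg x
    rw [apply_neg_of_eigen hf, (Nat.not_even_iff_odd.1 hk).neg_one_pow] at h
    exact hx (by rw [Pi.zero_apply]; linear_combination h / 2)
  · rintro ⟨S, hSV, hS1, hS⟩
    obtain ⟨f, hfS, hf0, hf⟩ := exists_eigen_of_isRightStable hS1 hS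
    have hd := eq_zero_of_mem_component_of_eigen hn (d := m - γ) (by omega) (hSV hfS) hf0 hf
    omega
  · rintro ⟨rfl, rfl, rfl⟩
    have hP := highestWeightVector_mem_component hn γ γ γ
    refine ⟨Submodule.span ℂ {highestWeightVector hn γ γ γ}, ?_,
      finrank_span_singleton (highestWeightVector_self_ne_zero hn γ), fun q f hf => ?_⟩
    · rwa [Submodule.span_singleton_le_iff_mem]
    · rwa [rightAct_eq_self_of_mem_component hn γ
        ((Submodule.span_singleton_le_iff_mem _ _).2 hP hf)]
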